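/- Let $q$ be a prime power and let $n,k,\ell,k_0$ be nonnegative integers with $\ell\le k\le 2n$ and $k=2k_0+\ell$. Equip $\mathbb F_q^{2n}$ with the symplectic inner product $\langle x,y\rangle_s=\sum_{i=1}^n(x_iy_{n+i}-x_{n+i}y_i)$; for a linear code (subspace) $C\subseteq\mathbb F_q^{2n}$ let $C^{\perp_s}=\{y\in\mathbb F_q^{2n}:\langle x,y\rangle_s=0\text{ for all }x\in C\}$ and $\mathrm{Hull}_s(C)=C\cap C^{\perp_s}$. Then the number of $k$-dimensional subspaces $C\subseteq\mathbb F_q^{2n}$ with $\dim\mathrm{Hull}_s(C)=\ell$ is $$\left(\prod_{i=1}^{\ell}\frac{q^{2n-2k_0-2i+2}-1}{q^{2k_0+i}-q^{2k_0}}\right)q^{2k_0(n-k_0)}\begin{bmatrix}n\\k_0\end{bmatrix}_{q^2},$$ where, for $Q=q^2$, $\begin{bmatrix}n\\k_0\end{bmatrix}_{Q}=\prod_{i=0}^{k_0-1}\frac{Q^n-Q^i}{Q^{k_0}-Q^i}$ (equal to $1$ for $k_0=0$), and empty products equal $1$. -/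

import Mathlib

/-- The symplectic inner product on `F ^ (2 n)`:
`⟨x, y⟩ = ∑_{i = 1}^{n} (x_i y_{n+i} - x_{n+i} y_i)` (coordinates are numbered from `0` here). -/
def symplecticInner {F : Type*} [Field F] (n : ℕ) (x y : Fin (2 * n) → F) : F :=
  ∑ i : Fin n,
    (x ⟨i, by omega⟩ * y ⟨n + i, by omega⟩ - x ⟨n + i, by omega⟩ * y ⟨i, by omega⟩)

/-- The symplectic dual `{y | ⟨x, y⟩ = 0 for all x ∈ C}` of a linear code `C` of length `2 n`. -/
def symplecticDual {F : Type*} [Field F] (n : ℕ) (C : Submodule F (Fin (2 * n) → F)) :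
    Submodule F (Fin (2 * n) → F) where
  carrier := {y | ∀ x ∈ C, symplecticInner n x y = 0}
  zero_mem' := by
    intro x _
    simp [symplecticInner]
  add_mem' := by
    intro a b ha hb x hx
    have h : symplecticInner n x (a + b) = symplecticInner n x a + symplecticInner n x b := by
      simp only [symplecticInner, Pi.add_apply, ← Finset.sum_add_distrib]
      exact Finset.sum_congr rfl fun i _ => by ring
    rw [h, ha x hx, hb x hx, add_zero]
  smul_mem' := by
    intro c a ha x hx
    have h : symplecticInner n x (c • a) = c * symplecticInner n x a := by
      simp only [symplecticInner, Pi.smul_apply, smul_eq_mul, Finset.mul_sum]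
      exact Finset.sum_congr rfl fun i _ => by ring
    rw [h, ha x hx, mul_zero]

/-- The symplectic hull of `C`: the intersection of `C` with its symplectic dual. -/
def symplecticHull {F : Type*} [Field F] (n : ℕ) (C : Submodule F (Fin (2 * n) → F)) :
    Submodule F (Fin (2 * n) → F) :=
  C ⊓ symplecticDual n C

/-- The set of all linear `[2n, k]` codes over `F` (the `k`-dimensional subspaces of `F ^ (2 n)`)
whose symplectic hull has dimension `l`. -/
def SHull (F : Type*) [Field F] (n k l : ℕ) : Set (Submodule F (Fin (2 * n) → F)) :=
  {C | Module.finrank F C = k ∧ Module.finrank F (symplecticHull n C) = l}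

/-- The Gaussian binomial coefficient
`[n choose k]_q = ((q^n - 1)(q^n - q) ⋯ (q^n - q^(k-1))) / ((q^k - 1)(q^k - q) ⋯ (q^k - q^(k-1)))`,
equal to `1` for `k = 0`, where the products are empty. -/
def gaussBinomial (q : ℚ) (n k : ℕ) : ℚ :=
  (∏ i ∈ Finset.range k, (q ^ n - q ^ i)) / (∏ i ∈ Finset.range k, (q ^ k - q ^ i))

/-- Counting a set of pairs by its fibres over the first component. -/
theorem ncard_eq_ncard_mul_of_fiber {α β : Type*} [Finite α] [Finite β] {s : Set (α × β)}
    {t : Set α} {m : ℕ} (hst : ∀ p ∈ s, p.1 ∈ t) (h : ∀ a ∈ t, {b | (a, b) ∈ s}.ncard = m) :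
    s.ncard = t.ncard * m := by
  classical
  cases nonempty_fintype α
  cases nonempty_fintype β
  rw [Set.ncard_eq_toFinset_card' s, Set.ncard_eq_toFinset_card' t,
    Finset.card_eq_sum_card_fiberwise (f := Prod.fst) (t := t.toFinset)
      (fun p hp => by simpa using hst p (by simpa using hp)),
    Finset.sum_const_nat (m := m)]
  intro a ha
  rw [← h a (by simpa using ha), Set.ncard_eq_toFinset_card']
  refine Finset.card_bij' (fun p _ => p.2) (fun b _ => (a, b)) ?_ ?_ ?_ ?_
  · rintro ⟨x, y⟩ hp
    simp only [Finset.mem_filter, Set.mem_toFinset, Set.mem_ofPred_eq] at hp ⊢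
    obtain ⟨hp, rfl⟩ := hp
    exact hp
  · intro b hb
    simpa using hb
  · rintro ⟨x, y⟩ hp
    simp only [Finset.mem_filter] at hp
    simp [hp.2]
  · intro b hb
    rfl

section Counting

variable {F V : Type*} [Field F] [AddCommGroup V] [Module F V] [FiniteDimensional F V]

theorem Submodule.ncard_eq_pow_finrank (D : Submodule F V) :
    (D : Set V).ncard = Nat.card F ^ Module.finrank F D := by
  rw [← Nat.card_coe_set_eq]
  exact Module.natCard_eq_pow_finrank (K := F) (V := D)

/-- The affine hyperplane cut out by a nonzero functional has `q ^ (dim - 1)` points. -/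
theorem ncard_functional_eq_one {g : V →ₗ[F] F} (hg : g ≠ 0) :
    {x | g x = 1}.ncard = Nat.card F ^ (Module.finrank F V - 1) := by
  obtain ⟨x, hx⟩ := DFunLike.ne_iff.mp hg
  have hx : g x ≠ 0 := hx
  have h1 : {x | g x = 1} = (fun y => (g x)⁻¹ • x + y) '' (LinearMap.ker g : Set V) := by
    ext z
    simp only [Set.mem_ofPred_eq, Set.mem_image, SetLike.mem_coe, LinearMap.mem_ker]
    constructor
    · intro hz
      exact ⟨z - (g x)⁻¹ • x, by simp [hz, hx], by abel⟩
    · rintro ⟨y, hy, rfl⟩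
      simp [hy, hx]
  rw [h1, Set.ncard_image_of_injective _ (add_right_injective _),
    Submodule.ncard_eq_pow_finrank, ← Module.Dual.finrank_ker_add_one_of_ne_zero hg,
    Nat.add_sub_cancel]

theorem ncard_mem_functional_eq_one {D : Submodule F V} {g : V →ₗ[F] F} (hg : ∃ x ∈ D, g x ≠ 0) :
    {x | x ∈ D ∧ g x = 1}.ncard = Nat.card F ^ (Module.finrank F D - 1) := by
  obtain ⟨x, hxD, hx⟩ := hg
  have h0 : g.domRestrict D ≠ 0 := fun h => hx (by simpa using congr($h ⟨x, hxD⟩))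
  rw [← ncard_functional_eq_one h0, ← Set.ncard_image_of_injective _ D.subtype_injective]
  congr 1
  ext z
  simp [and_comm]

/-- The number of complements of a line in `C`. -/
theorem ncard_compl_span_singleton {C : Submodule F V} {w : V} (hwC : w ∈ C) (hw : w ≠ 0) :
    {C' : Submodule F V | w ∉ C' ∧ C' ⊔ Submodule.span F {w} = C}.ncard =
      Nat.card F ^ (Module.finrank F C - 1) := by
  have hev : Module.Dual.eval F C ⟨w, hwC⟩ ≠ 0 := by
    rw [Ne, Module.eval_apply_eq_zero_iff]
    simpa using hw
  rw [← Subspace.dual_finrank_eq (K := F) (V := C), ← ncard_functional_eq_one hev]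
  symm
  refine Set.ncard_congr (fun φ _ => (LinearMap.ker φ).map C.subtype) ?_ ?_ ?_
  · intro φ hφ
    have hφ : φ ⟨w, hwC⟩ = 1 := hφ
    refine ⟨?_, le_antisymm (sup_le (Submodule.map_subtype_le _ _) (by simpa using hwC)) ?_⟩
    · rintro ⟨y, hy, hyw⟩
      obtain rfl : y = ⟨w, hwC⟩ := Subtype.ext hyw
      simp [hφ] at hy
    · intro x hx
      refine Submodule.mem_sup.mpr ⟨x - φ ⟨x, hx⟩ • w, ⟨⟨x, hx⟩ - φ ⟨x, hx⟩ • ⟨w, hwC⟩, ?_, rfl⟩,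
        φ ⟨x, hx⟩ • w, Submodule.smul_mem _ _ (Submodule.mem_span_singleton_self w), by abel⟩
      rw [SetLike.mem_coe, LinearMap.mem_ker, map_sub, map_smul, hφ, smul_eq_mul, mul_one, sub_self]
  · intro φ ψ hφ hψ h
    have hφ : φ ⟨w, hwC⟩ = 1 := hφ
    have hψ : ψ ⟨w, hwC⟩ = 1 := hψ
    have hker := Submodule.map_injective_of_injective C.subtype_injective h
    ext x
    have hx : x - φ x • ⟨w, hwC⟩ ∈ LinearMap.ker ψ := by
      rw [← hker, LinearMap.mem_ker, map_sub, map_smul, hφ, smul_eq_mul, mul_one, sub_self]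
    simp only [LinearMap.mem_ker, map_sub, map_smul, hψ, smul_eq_mul, mul_one] at hx
    exact (sub_eq_zero.mp hx).symm
  · rintro C' ⟨hwC', hC⟩
    obtain ⟨f, hf, hker⟩ := Submodule.exists_le_ker_of_notMem hwC'
    refine ⟨((f w)⁻¹ • f).domRestrict C, by simp [hf], ?_⟩
    ext x
    constructor
    · rintro ⟨⟨y, hy⟩, hfy, rfl⟩
      have hfy : f y = 0 := by simpa [hf] using hfy
      rw [← hC] at hy
      obtain ⟨c, hc, z, hz, rfl⟩ := Submodule.mem_sup.mp hy
      obtain ⟨a, rfl⟩ := Submodule.mem_span_singleton.mp hz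
      have hfc : f c = 0 := hker hc
      have ha : a = 0 := by simpa [hfc, hf] using hfy
      simpa [ha] using hc
    · intro hx
      have hfx : f x = 0 := hker hx
      exact ⟨⟨x, hC ▸ Submodule.mem_sup_left hx⟩, by simp [hfx], rfl⟩

end Counting

section Forms

open LinearMap (BilinForm)
open Module (finrank)
open Submodule (span)

variable {F V : Type*} [Field F] [AddCommGroup V] [Module F V]

/-- The subspaces of dimension `d` whose hull with respect to `B` has dimension `l`. -/
def hullCodes (B : BilinForm F V) (d l : ℕ) : Set (Submodule F V) :=
  {C | finrank F C = d ∧ finrank F ↥(C ⊓ B.orthogonal C) = l}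

theorem LinearMap.BilinForm.mem_orthogonal_sup {B : BilinForm F V} {C D : Submodule F V} {x : V} :
    x ∈ B.orthogonal (C ⊔ D) ↔ x ∈ B.orthogonal C ∧ x ∈ B.orthogonal D := by
  refine ⟨fun h => ⟨fun y hy => h y (Submodule.mem_sup_left hy),
    fun y hy => h y (Submodule.mem_sup_right hy)⟩, fun ⟨h1, h2⟩ y hy => ?_⟩
  obtain ⟨c, hc, d, hd, rfl⟩ := Submodule.mem_sup.mp hy
  have e1 : B c x = 0 := h1 c hc
  have e2 : B d x = 0 := h2 d hd
  simp [e1, e2]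

theorem LinearMap.BilinForm.mem_orthogonal_span_singleton {B : BilinForm F V} {w x : V} :
    x ∈ B.orthogonal (span F {w}) ↔ B w x = 0 := by
  refine ⟨fun h => h w (Submodule.mem_span_singleton_self w), fun h y hy => ?_⟩
  obtain ⟨a, rfl⟩ := Submodule.mem_span_singleton.mp hy
  simp [h]

theorem LinearMap.BilinForm.mem_orthogonal_span_pair {B : BilinForm F V} {e f x : V} :
    x ∈ B.orthogonal (span F {e, f}) ↔ B e x = 0 ∧ B f x = 0 := by
  rw [Submodule.span_insert, mem_orthogonal_sup, mem_orthogonal_span_singleton,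
    mem_orthogonal_span_singleton]

variable {B : BilinForm F V}

/-- Adjoining a vector of the dual code to `C` adjoins it to the hull. -/
theorem hull_sup_span_singleton (hB : B.IsAlt) {C : Submodule F V} {w : V}
    (hw : w ∈ B.orthogonal C) :
    (C ⊔ span F {w}) ⊓ B.orthogonal (C ⊔ span F {w}) = (C ⊓ B.orthogonal C) ⊔ span F {w} := by
  apply le_antisymm
  · rintro x ⟨hx, hx'⟩
    obtain ⟨hx', -⟩ := BilinForm.mem_orthogonal_sup.mp hx'
    obtain ⟨c, hc, z, hz, rfl⟩ := Submodule.mem_sup.mp hx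
    have hz' : z ∈ B.orthogonal C := (Submodule.span_singleton_le_iff_mem w _).mpr hw hz
    exact Submodule.add_mem_sup ⟨hc, by simpa using sub_mem hx' hz'⟩ hz
  · refine sup_le (fun c hc => ⟨Submodule.mem_sup_left hc.1, ?_⟩) ?_
    · rw [SetLike.mem_coe, BilinForm.mem_orthogonal_sup, BilinForm.mem_orthogonal_span_singleton]
      exact ⟨hc.2, hB.isRefl _ _ (hw c hc.1)⟩
    · rw [Submodule.span_singleton_le_iff_mem]
      refine ⟨Submodule.mem_sup_right (Submodule.mem_span_singleton_self w), ?_⟩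
      rw [SetLike.mem_coe, BilinForm.mem_orthogonal_sup, BilinForm.mem_orthogonal_span_singleton]
      exact ⟨hw, hB w⟩

variable [FiniteDimensional F V]

theorem sup_span_singleton_mem_hullCodes (hB : B.IsAlt) {C : Submodule F V} {w : V} {d l : ℕ}
    (hw : w ∈ B.orthogonal C) (hwC : w ∉ C) :
    C ⊔ span F {w} ∈ hullCodes B (d + 1) (l + 1) ↔ C ∈ hullCodes B d l := by
  rw [hullCodes, hullCodes, Set.mem_ofPred_eq, Set.mem_ofPred_eq, hull_sup_span_singleton hB hw,
    Submodule.finrank_sup_span_singleton hwC,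
    Submodule.finrank_sup_span_singleton (fun h => hwC (Submodule.mem_inf.mp h).1), Nat.add_right_cancel_iff,
    Nat.add_right_cancel_iff]

variable [Finite F]

theorem ncard_hullCodes_succ_mul (hB : B.IsAlt) (hnd : B.Nondegenerate) (d l : ℕ) :
    (hullCodes B (d + 1) (l + 1)).ncard * ((Nat.card F ^ (l + 1) - 1) * Nat.card F ^ d) =
      (hullCodes B d l).ncard * (Nat.card F ^ (finrank F V - d) - Nat.card F ^ l) := by
  have : Finite V := Module.finite_of_finite F
  have h1 : {p : Submodule F V × V | p.1 ∈ hullCodes B d l ∧ p.2 ∈ B.orthogonal p.1 ∧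
      p.2 ∉ p.1}.ncard = (hullCodes B d l).ncard *
        (Nat.card F ^ (finrank F V - d) - Nat.card F ^ l) := by
    refine ncard_eq_ncard_mul_of_fiber (fun p hp => hp.1) fun C hC => ?_
    have : {w | (C, w) ∈ {p : Submodule F V × V | p.1 ∈ hullCodes B d l ∧
        p.2 ∈ B.orthogonal p.1 ∧ p.2 ∉ p.1}} =
        (B.orthogonal C : Set V) \ (C ⊓ B.orthogonal C : Submodule F V) := by
      ext w
      simp only [Set.mem_ofPred_eq, Set.mem_sdiff, SetLike.mem_coe, Submodule.mem_inf]
      tauto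
    rw [this, Set.ncard_sdiff (fun x hx => hx.2), Submodule.ncard_eq_pow_finrank,
      Submodule.ncard_eq_pow_finrank, BilinForm.finrank_orthogonal hnd, hC.1, hC.2]
  have h2 : {p : Submodule F V × V | p.1 ∈ hullCodes B (d + 1) (l + 1) ∧
      p.2 ∈ p.1 ⊓ B.orthogonal p.1 ∧ p.2 ≠ 0}.ncard =
        (hullCodes B (d + 1) (l + 1)).ncard * (Nat.card F ^ (l + 1) - 1) := by
    refine ncard_eq_ncard_mul_of_fiber (fun p hp => hp.1) fun C hC => ?_
    have : {w | (C, w) ∈ {p : Submodule F V × V | p.1 ∈ hullCodes B (d + 1) (l + 1) ∧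
        p.2 ∈ p.1 ⊓ B.orthogonal p.1 ∧ p.2 ≠ 0}} =
        ((C ⊓ B.orthogonal C : Submodule F V) : Set V) \ {0} := by
      ext w
      simp only [Set.mem_ofPred_eq, Set.mem_sdiff, SetLike.mem_coe, Set.mem_singleton_iff]
      tauto
    rw [this, Set.ncard_sdiff (by simp), Submodule.ncard_eq_pow_finrank, Set.ncard_singleton, hC.2]
  rw [← h1, ← mul_assoc, ← h2]
  rw [← ncard_eq_ncard_mul_of_fiber (s := {t : (Submodule F V × V) × Submodule F V |
    (t.1.1 ∈ hullCodes B (d + 1) (l + 1) ∧ t.1.2 ∈ t.1.1 ⊓ B.orthogonal t.1.1 ∧ t.1.2 ≠ 0) ∧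
      t.1.2 ∉ t.2 ∧ t.2 ⊔ span F {t.1.2} = t.1.1}) (fun p hp => hp.1)]
  · refine Set.ncard_congr (fun t _ => (t.2, t.1.2)) ?_ ?_ ?_
    · rintro ⟨⟨C, w⟩, C'⟩ ⟨⟨hC, hw, -⟩, hwC', rfl : C' ⊔ span F {w} = C⟩
      have hwo : w ∈ B.orthogonal C' := (BilinForm.mem_orthogonal_sup.mp hw.2).1
      exact ⟨(sup_span_singleton_mem_hullCodes hB hwo hwC').mp hC, hwo, hwC'⟩
    · rintro ⟨⟨C, w⟩, C'⟩ ⟨⟨D, v⟩, D'⟩ ⟨-, -, hC⟩ ⟨-, -, hD⟩ h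
      simp only [Prod.mk.injEq] at h hC hD ⊢
      obtain ⟨rfl, rfl⟩ := h
      exact ⟨⟨hC ▸ hD, rfl⟩, rfl⟩
    · rintro ⟨C', w⟩ ⟨hC', hw, hwC'⟩
      refine ⟨((C' ⊔ span F {w}, w), C'), ⟨⟨?_, ?_, ?_⟩, hwC', rfl⟩, rfl⟩
      · exact (sup_span_singleton_mem_hullCodes hB hw hwC').mpr hC'
      · rw [hull_sup_span_singleton hB hw]
        exact Submodule.mem_sup_right (Submodule.mem_span_singleton_self w)
      · rintro rfl
        exact hwC' (zero_mem _)
  · rintro ⟨C, w⟩ ⟨hC, hw, hw0⟩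
    have := ncard_compl_span_singleton hw.1 hw0
    rw [hC.1, Nat.add_sub_cancel] at this
    rw [← this]
    congr 1
    ext C'
    exact ⟨fun h => h.2, fun h => ⟨⟨hC, hw, hw0⟩, h⟩⟩

/-- The number of hyperbolic pairs in `D`. -/
theorem ncard_hyperbolic_pairs {D : Submodule F V} {d l : ℕ} (hB : B.IsAlt)
    (hD : D ∈ hullCodes B d l) :
    {p : V × V | p.1 ∈ D ∧ p.2 ∈ D ∧ B p.1 p.2 = 1}.ncard =
      (Nat.card F ^ d - Nat.card F ^ l) * Nat.card F ^ (d - 1) := by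
  have : Finite V := Module.finite_of_finite F
  have h : ((D : Set V) \ (D ⊓ B.orthogonal D : Submodule F V)).ncard =
      Nat.card F ^ d - Nat.card F ^ l := by
    rw [Set.ncard_sdiff (fun x hx => hx.1), Submodule.ncard_eq_pow_finrank,
      Submodule.ncard_eq_pow_finrank, hD.1, hD.2]
  rw [← h]
  refine ncard_eq_ncard_mul_of_fiber ?_ ?_
  · rintro ⟨e, f⟩ ⟨he, hf, hef : B e f = 1⟩
    refine ⟨he, fun h => ?_⟩
    rw [hB.isRefl _ _ (h.2 f hf)] at hef
    exact zero_ne_one hef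
  · rintro e ⟨he, he'⟩
    have hx : ∃ x ∈ D, B e x ≠ 0 := by
      by_contra! hcon
      exact he' ⟨he, fun x hx => hB.isRefl _ _ (hcon x hx)⟩
    rw [← hD.1, ← ncard_mem_functional_eq_one hx]
    congr 1
    ext f
    exact ⟨fun h => h.2, fun h => ⟨he, h⟩⟩

end Forms

section Nondegenerate

open LinearMap (BilinForm)
open Module (finrank)
open Submodule (span)

variable {F V : Type*} [Field F] [AddCommGroup V] [Module F V] {B : BilinForm F V}

theorem disjoint_span_pair_orthogonal (hB : B.IsAlt) {e f : V} (hef : B e f = 1) :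
    Disjoint (span F {e, f}) (B.orthogonal (span F {e, f})) := by
  rw [Submodule.disjoint_def]
  intro x hx hx'
  have hfe : B f e = -1 := by rw [← hB.neg_eq, hef]
  obtain ⟨a, b, rfl⟩ := Submodule.mem_span_pair.mp hx
  obtain ⟨h1, h2⟩ := BilinForm.mem_orthogonal_span_pair.mp hx'
  have hb : b = 0 := by simpa [hef, hB e] using h1
  have ha : a = 0 := by simpa [hfe, hB f] using h2
  simp [ha, hb]

theorem finrank_span_hyperbolic_pair (hB : B.IsAlt) {e f : V} (hef : B e f = 1) :
    finrank F (span F {e, f}) = 2 := by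
  have hfe : B f e = -1 := by rw [← hB.neg_eq, hef]
  have : LinearIndependent F ![e, f] := by
    rw [LinearIndependent.pair_iff]
    intro a b h
    have h1 := congr(B e $h)
    have h2 := congr(B f $h)
    simp only [map_add, map_smul, hB e, hB f, hef, hfe, map_zero] at h1 h2
    simp at h1 h2
    exact ⟨h2, h1⟩
  have h := finrank_span_eq_card this
  rwa [Matrix.range_cons, Matrix.range_cons, Matrix.range_empty, Set.union_empty,
    Set.singleton_union, Fintype.card_fin] at h

/-- A hyperbolic plane inside `C` splits off. -/
theorem sup_span_pair_eq_of_mem (hB : B.IsAlt) {C : Submodule F V} {e f : V} (he : e ∈ C)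
    (hf : f ∈ C) (hef : B e f = 1) :
    C ⊓ B.orthogonal (span F {e, f}) ⊔ span F {e, f} = C := by
  have hP : span F {e, f} ≤ C := Submodule.span_le.mpr (by simp [Set.insert_subset_iff, he, hf])
  have hfe : B f e = -1 := by rw [← hB.neg_eq, hef]
  refine le_antisymm (sup_le inf_le_left hP) fun x hx => ?_
  have hp : B e x • f - B f x • e ∈ span F {e, f} :=
    Submodule.mem_span_pair.mpr ⟨-B f x, B e x, by rw [neg_smul]; abel⟩
  refine Submodule.mem_sup.mpr ⟨x - (B e x • f - B f x • e), ⟨sub_mem hx (hP hp), ?_⟩, _, hp,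
    sub_add_cancel _ _⟩
  rw [SetLike.mem_coe, BilinForm.mem_orthogonal_span_pair]
  simp [hef, hfe, hB e, hB f]

/-- Splitting off a hyperbolic plane orthogonal to `C` recovers `C`. -/
theorem sup_span_pair_inf_orthogonal (hB : B.IsAlt) {C : Submodule F V} {e f : V}
    (he : e ∈ B.orthogonal C) (hf : f ∈ B.orthogonal C) (hef : B e f = 1) :
    (C ⊔ span F {e, f}) ⊓ B.orthogonal (span F {e, f}) = C := by
  have hC : C ≤ B.orthogonal (span F {e, f}) := fun x hx =>
    BilinForm.mem_orthogonal_span_pair.mpr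
      ⟨hB.isRefl _ _ (he x hx), hB.isRefl _ _ (hf x hx)⟩
  rw [sup_inf_assoc_of_le _ hC, (disjoint_span_pair_orthogonal hB hef).eq_bot, sup_bot_eq]

variable [FiniteDimensional F V]

theorem add_le_finrank_of_mem_hullCodes (hnd : B.Nondegenerate) {C : Submodule F V} {d l : ℕ}
    (hC : C ∈ hullCodes B d l) : d + l ≤ finrank F V := by
  have h1 := Submodule.finrank_mono (inf_le_right : C ⊓ B.orthogonal C ≤ B.orthogonal C)
  have h2 := Submodule.finrank_le C
  rw [BilinForm.finrank_orthogonal hnd, hC.1, hC.2] at h1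
  rw [hC.1] at h2
  omega

theorem mem_hullCodes_zero {C : Submodule F V} {d : ℕ} :
    C ∈ hullCodes B d 0 ↔ finrank F C = d ∧ Disjoint C (B.orthogonal C) := by
  rw [hullCodes, Set.mem_ofPred_eq, Submodule.finrank_eq_zero, disjoint_iff]

theorem sup_span_pair_mem_hullCodes (hB : B.IsAlt) {C : Submodule F V} {e f : V} {d : ℕ}
    (he : e ∈ B.orthogonal C) (hf : f ∈ B.orthogonal C) (hef : B e f = 1) :
    C ⊔ span F {e, f} ∈ hullCodes B (d + 2) 0 ↔ C ∈ hullCodes B d 0 := by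
  have hP := disjoint_span_pair_orthogonal hB hef
  have hPC : span F {e, f} ≤ B.orthogonal C :=
    Submodule.span_le.mpr (by simp [Set.insert_subset_iff, he, hf])
  have hCP : C ≤ B.orthogonal (span F {e, f}) := fun x hx y hy => hB.isRefl _ _ (hPC hy x hx)
  have hd : C ⊓ span F {e, f} = ⊥ := (hP.mono_right hCP).symm.eq_bot
  have hdim := Submodule.finrank_sup_add_finrank_inf_eq C (span F {e, f})
  rw [hd, finrank_bot, add_zero, finrank_span_hyperbolic_pair hB hef] at hdim
  rw [mem_hullCodes_zero, mem_hullCodes_zero, hdim, Nat.add_right_cancel_iff]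
  refine and_congr_right fun _ => ?_
  rw [Submodule.disjoint_def, Submodule.disjoint_def]
  constructor
  · intro h x hx hx'
    exact h x (Submodule.mem_sup_left hx) (BilinForm.mem_orthogonal_sup.mpr ⟨hx', hCP hx⟩)
  · intro h x hx hx'
    obtain ⟨h1, h2⟩ := BilinForm.mem_orthogonal_sup.mp hx'
    have hxC : x ∈ (C ⊔ span F {e, f}) ⊓ B.orthogonal (span F {e, f}) := ⟨hx, h2⟩
    rw [sup_span_pair_inf_orthogonal hB he hf hef] at hxC
    exact h x hxC h1

theorem orthogonal_mem_hullCodes_zero (hB : B.IsAlt) (hnd : B.Nondegenerate) {C : Submodule F V}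
    {d : ℕ} (hC : C ∈ hullCodes B d 0) :
    B.orthogonal C ∈ hullCodes B (finrank F V - d) 0 := by
  rw [mem_hullCodes_zero] at hC ⊢
  rw [BilinForm.finrank_orthogonal hnd, BilinForm.orthogonal_orthogonal hnd hB.isRefl, hC.1]
  exact ⟨rfl, hC.2.symm⟩

theorem ncard_hullCodes_zero_zero : (hullCodes B 0 0).ncard = 1 := by
  rw [Set.ncard_eq_one]
  refine ⟨⊥, Set.ext fun C => ?_⟩
  rw [mem_hullCodes_zero, Submodule.finrank_eq_zero, Set.mem_singleton_iff]
  exact ⟨fun h => h.1, fun h => ⟨h, h ▸ disjoint_bot_left⟩⟩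

theorem ncard_hullCodes_add_two_mul [Finite F] (hB : B.IsAlt) (hnd : B.Nondegenerate) (d : ℕ) :
    (hullCodes B (d + 2) 0).ncard * ((Nat.card F ^ (d + 2) - 1) * Nat.card F ^ (d + 1)) =
      (hullCodes B d 0).ncard * ((Nat.card F ^ (finrank F V - d) - 1) *
        Nat.card F ^ (finrank F V - d - 1)) := by
  have : Finite V := Module.finite_of_finite F
  rw [← ncard_eq_ncard_mul_of_fiber (s := {p : Submodule F V × V × V |
      p.1 ∈ hullCodes B (d + 2) 0 ∧ p.2.1 ∈ p.1 ∧ p.2.2 ∈ p.1 ∧ B p.2.1 p.2.2 = 1})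
      (fun p hp => hp.1) fun C hC => ?_,
    ← ncard_eq_ncard_mul_of_fiber (s := {p : Submodule F V × V × V |
      p.1 ∈ hullCodes B d 0 ∧ p.2.1 ∈ B.orthogonal p.1 ∧ p.2.2 ∈ B.orthogonal p.1 ∧
        B p.2.1 p.2.2 = 1}) (fun p hp => hp.1) fun C hC => ?_]
  · refine Set.ncard_congr (fun p _ => (p.1 ⊓ B.orthogonal (span F {p.2.1, p.2.2}), p.2)) ?_ ?_ ?_
    · rintro ⟨C, e, f⟩ ⟨hC, he, hf, hef⟩
      have key (x : V) (hx : x ∈ ({e, f} : Set V)) :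
          x ∈ B.orthogonal (C ⊓ B.orthogonal (span F {e, f})) := fun y hy =>
        hB.isRefl _ _ (hy.2 x (Submodule.subset_span hx))
      have he' := key e (by simp)
      have hf' := key f (by simp)
      refine ⟨(sup_span_pair_mem_hullCodes hB he' hf' hef).mp ?_, he', hf', hef⟩
      rwa [sup_span_pair_eq_of_mem hB he hf hef]
    · rintro ⟨C, e, f⟩ ⟨D, e', f'⟩ ⟨-, he, hf, hef⟩ ⟨-, he', hf', hef'⟩ h
      simp only [Prod.mk.injEq] at h he hf hef he' hf' hef' ⊢
      obtain ⟨h, rfl, rfl⟩ := h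
      refine ⟨?_, rfl, rfl⟩
      rw [← sup_span_pair_eq_of_mem hB he hf hef, h, sup_span_pair_eq_of_mem hB he' hf' hef]
    · rintro ⟨C, e, f⟩ ⟨hC, he, hf, hef⟩
      refine ⟨(C ⊔ span F {e, f}, e, f),
        ⟨(sup_span_pair_mem_hullCodes hB he hf hef).mpr hC,
          Submodule.mem_sup_right (Submodule.subset_span (by simp)),
          Submodule.mem_sup_right (Submodule.subset_span (by simp)), hef⟩, ?_⟩
      exact Prod.ext (sup_span_pair_inf_orthogonal hB he hf hef) rfl
  · have := ncard_hyperbolic_pairs hB (orthogonal_mem_hullCodes_zero hB hnd hC)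
    rw [pow_zero] at this
    rw [← this]
    congr 1
    ext p
    exact ⟨fun h => h.2, fun h => ⟨hC, h⟩⟩
  · have := ncard_hyperbolic_pairs hB hC
    rw [pow_zero, show d + 2 - 1 = d + 1 from rfl] at this
    rw [← this]
    congr 1
    ext p
    exact ⟨fun h => h.2, fun h => ⟨hC, h⟩⟩

end Nondegenerate

section Symplectic

open LinearMap (BilinForm)
open Module (finrank)

variable {F : Type*} [Field F]

/-- The symplectic inner product as a bilinear form. -/
def symplecticForm (F : Type*) [Field F] (n : ℕ) : BilinForm F (Fin (2 * n) → F) :=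
  LinearMap.mk₂ F (symplecticInner n)
    (fun x y z => by
      simp only [symplecticInner, Pi.add_apply, ← Finset.sum_add_distrib]
      exact Finset.sum_congr rfl fun i _ => by ring)
    (fun c x y => by
      simp only [symplecticInner, Pi.smul_apply, smul_eq_mul, Finset.mul_sum]
      exact Finset.sum_congr rfl fun i _ => by ring)
    (fun x y z => by
      simp only [symplecticInner, Pi.add_apply, ← Finset.sum_add_distrib]
      exact Finset.sum_congr rfl fun i _ => by ring)
    (fun c x y => by
      simp only [symplecticInner, Pi.smul_apply, smul_eq_mul, Finset.mul_sum]
      exact Finset.sum_congr rfl fun i _ => by ring)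

theorem symplecticForm_apply (n : ℕ) (x y : Fin (2 * n) → F) :
    symplecticForm F n x y = symplecticInner n x y := rfl

theorem symplecticForm_isAlt (n : ℕ) : (symplecticForm F n).IsAlt := by
  intro x
  rw [symplecticForm_apply, symplecticInner]
  exact Finset.sum_eq_zero fun i _ => by ring

theorem symplecticForm_nondegenerate (n : ℕ) : (symplecticForm F n).Nondegenerate := by
  refine (LinearMap.IsRefl.nondegenerate_iff_separatingLeft (B := symplecticForm F n)
    (fun x y => (symplecticForm_isAlt n).isRefl x y)).mpr ?_
  intro x hx
  ext j
  have hj := j.isLt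
  by_cases hjn : (j : ℕ) < n
  · have h := hx (Pi.single ⟨n + j, by omega⟩ 1)
    rw [symplecticForm_apply, symplecticInner, Finset.sum_eq_single ⟨j, hjn⟩] at h
    · simpa [Pi.single_apply, Fin.ext_iff, show n ≠ 0 by omega] using h
    · intro i _ hij
      have hij : (i : ℕ) ≠ j := fun h => hij (Fin.ext h)
      simp [Fin.ext_iff, hij, show (i : ℕ) ≠ n + j by omega]
    · simp
  · have h := hx (Pi.single ⟨j - n, by omega⟩ 1)
    rw [symplecticForm_apply, symplecticInner,
      Finset.sum_eq_single ⟨j - n, by omega⟩] at h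
    · have e : (⟨n + (j - n), by omega⟩ : Fin (2 * n)) = j := Fin.ext (by simp; omega)
      simpa [Pi.single_apply, Fin.ext_iff, e, show (j : ℕ) ≠ j - n by omega] using h
    · intro i _ hij
      have hij : (i : ℕ) ≠ j - n := fun h => hij (Fin.ext h)
      simp [Fin.ext_iff, hij, show n + (i : ℕ) ≠ j - n by omega]
    · simp

theorem SHull_eq_hullCodes (n k l : ℕ) : SHull F n k l = hullCodes (symplecticForm F n) k l := rfl

end Symplectic

theorem gaussBinomial_succ_right {q : ℚ} (hq : 1 < q) {n k : ℕ} (hk : k < n) :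
    gaussBinomial q n (k + 1) = gaussBinomial q n k * ((q ^ (n - k) - 1) / (q ^ (k + 1) - 1)) := by
  have hden : ∏ i ∈ Finset.range (k + 1), (q ^ (k + 1) - q ^ i) =
      (q ^ (k + 1) - 1) * (q ^ k * ∏ i ∈ Finset.range k, (q ^ k - q ^ i)) := by
    have h : ∏ i ∈ Finset.range k, (q ^ (k + 1) - q ^ (i + 1)) =
        ∏ i ∈ Finset.range k, q * (q ^ k - q ^ i) := Finset.prod_congr rfl fun i _ => by ring
    rw [Finset.prod_range_succ', mul_comm, pow_zero, h, Finset.prod_mul_distrib,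
      Finset.prod_const, Finset.card_range]
  have hne : ∏ i ∈ Finset.range k, (q ^ k - q ^ i) ≠ 0 :=
    Finset.prod_ne_zero_iff.mpr fun i hi =>
      (sub_pos.mpr (pow_lt_pow_right₀ hq (Finset.mem_range.mp hi))).ne'
  have hne' : q ^ (k + 1) - 1 ≠ 0 := (sub_pos.mpr (one_lt_pow₀ hq k.succ_ne_zero)).ne'
  have hn : q ^ n = q ^ k * q ^ (n - k) := by rw [← pow_add]; congr 1; omega
  have hqk : q ^ k ≠ 0 := by positivity
  rw [gaussBinomial, gaussBinomial, hden, Finset.prod_range_succ, div_mul_div_comm, div_eq_div_iff (by positivity) (by positivity), hn]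
  ring

section Count

open LinearMap (BilinForm)
open Module (finrank)

variable {F V : Type*} [Field F] [Finite F] [AddCommGroup V] [Module F V] [FiniteDimensional F V]
  {B : BilinForm F V} {n : ℕ}

/-- The number of nondegenerate subspaces of a symplectic space. -/
theorem ncard_hullCodes_zero (hB : B.IsAlt) (hnd : B.Nondegenerate) (hV : finrank F V = 2 * n)
    {k : ℕ} (hk : k ≤ n) :
    ((hullCodes B (2 * k) 0).ncard : ℚ) =
      (Nat.card F : ℚ) ^ (2 * k * (n - k)) * gaussBinomial ((Nat.card F : ℚ) ^ 2) n k := by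
  have hq : (1 : ℚ) < Nat.card F := by exact_mod_cast Finite.one_lt_card
  have hq' (m : ℕ) : 1 ≤ Nat.card F ^ m := Nat.one_le_pow _ _ Nat.card_pos
  induction k with
  | zero => simp [ncard_hullCodes_zero_zero, gaussBinomial]
  | succ k ih =>
    have hrec := ncard_hullCodes_add_two_mul hB hnd (2 * k)
    obtain ⟨m, rfl⟩ : ∃ m, n = k + m + 1 := ⟨n - k - 1, by omega⟩
    rw [hV, show 2 * (k + m + 1) - 2 * k = 2 * (m + 1) by omega,
      show 2 * (m + 1) - 1 = 2 * m + 1 by omega] at hrec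
    have hrec := congrArg (Nat.cast : ℕ → ℚ) hrec
    push_cast [Nat.cast_sub (hq' _)] at hrec
    rw [ih (by omega)] at hrec
    rw [gaussBinomial_succ_right (one_lt_pow₀ hq two_ne_zero) (by omega)]
    rw [show k + m + 1 - k = m + 1 by omega] at hrec ⊢
    rw [show k + m + 1 - (k + 1) = m by omega]
    rw [show 2 * (k + 1) = 2 * k + 2 by ring]
    generalize (Nat.card F : ℚ) = q at *
    have h1 : q ^ (2 * k + 2) - 1 ≠ 0 := (sub_pos.mpr (one_lt_pow₀ hq (by omega))).ne'
    have h2 : q ^ (2 * k + 1) ≠ 0 := by positivity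
    apply mul_right_cancel₀ (mul_ne_zero h1 h2)
    rw [hrec, ← pow_mul, ← pow_mul, show 2 * (k + 1) = 2 * k + 2 by ring]
    field_simp
    ring

theorem ncard_hullCodes (hB : B.IsAlt) (hnd : B.Nondegenerate) (hV : finrank F V = 2 * n)
    (k l : ℕ) (hkl : 2 * k + l ≤ 2 * n) :
    ((hullCodes B (2 * k + l) l).ncard : ℚ) =
      (∏ i ∈ Finset.Icc 1 l,
        ((Nat.card F : ℚ) ^ (2 * (n : ℤ) - 2 * (k : ℤ) - 2 * (i : ℤ) + 2) - 1) /
          ((Nat.card F : ℚ) ^ (2 * k + i) - (Nat.card F : ℚ) ^ (2 * k))) *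
        (Nat.card F : ℚ) ^ (2 * k * (n - k)) * gaussBinomial ((Nat.card F : ℚ) ^ 2) n k := by
  have hq : (1 : ℚ) < Nat.card F := by exact_mod_cast Finite.one_lt_card
  have hq' (m : ℕ) : 1 ≤ Nat.card F ^ m := Nat.one_le_pow _ _ Nat.card_pos
  induction l with
  | zero => simp [ncard_hullCodes_zero hB hnd hV (show k ≤ n by omega)]
  | succ l ih =>
    have ih := ih (by omega)
    have hrec := congrArg (Nat.cast : ℕ → ℚ) (ncard_hullCodes_succ_mul hB hnd (2 * k + l) l)
    rw [Finset.prod_Icc_succ_top (by omega), mul_right_comm _ _ (_ ^ (2 * k * (n - k))),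
      mul_right_comm _ _ (gaussBinomial _ _ _), ← ih, ← add_assoc]
    rcases (hullCodes B (2 * k + l) l).eq_empty_or_nonempty with h0 | ⟨C, hC⟩
    · rw [h0, Set.ncard_empty, zero_mul, Nat.cast_zero] at hrec
      have hpos : (Nat.card F ^ (l + 1) - 1) * Nat.card F ^ (2 * k + l) ≠ 0 :=
        (Nat.mul_pos (Nat.sub_pos_of_lt (Nat.one_lt_pow l.succ_ne_zero Finite.one_lt_card))
          (hq' _)).ne'
      rw [h0, Set.ncard_empty, Nat.cast_zero, zero_mul]
      exact_mod_cast (mul_eq_zero.mp (Nat.cast_eq_zero.mp hrec)).resolve_right hpos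
    obtain ⟨m, hm⟩ := Nat.exists_eq_add_of_le (add_le_finrank_of_mem_hullCodes hnd hC)
    rw [hV] at hm hrec
    rw [show 2 * n - (2 * k + l) = l + m by omega] at hrec
    push_cast [Nat.cast_sub (hq' _), Nat.cast_sub (Nat.pow_le_pow_right (Nat.card_pos (α := F))
      (Nat.le_add_right l m))] at hrec
    rw [show 2 * (n : ℤ) - 2 * (k : ℤ) - 2 * ((l + 1 : ℕ) : ℤ) + 2 = (m : ℤ) by push_cast; omega,
      zpow_natCast]
    generalize (Nat.card F : ℚ) = q at *
    have h1 : q ^ (l + 1) - 1 ≠ 0 := (sub_pos.mpr (one_lt_pow₀ hq (by omega))).ne'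
    have h2 : q ^ (2 * k + l) ≠ 0 := by positivity
    have h3 : q ^ (2 * k + l + 1) - q ^ (2 * k) = q ^ (2 * k) * (q ^ (l + 1) - 1) := by ring
    apply mul_right_cancel₀ (mul_ne_zero h1 h2)
    rw [hrec, h3]
    field_simp
    ring

end Count

theorem theorem4p10 (F : Type*) [Field F] [Fintype F] (q : ℕ) (hq : Fintype.card F = q)
    (n k l k₀ : ℕ) (hlk : l ≤ k) (hkn : k ≤ 2 * n) (hk : k = 2 * k₀ + l) :
    ((SHull F n k l).ncard : ℚ) =
      (∏ i ∈ Finset.Icc 1 l,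
        ((q : ℚ) ^ (2 * (n : ℤ) - 2 * (k₀ : ℤ) - 2 * (i : ℤ) + 2) - 1) /
          ((q : ℚ) ^ (2 * k₀ + i) - (q : ℚ) ^ (2 * k₀))) *
        (q : ℚ) ^ (2 * k₀ * (n - k₀)) * gaussBinomial ((q : ℚ) ^ 2) n k₀ := by
  subst hk
  rw [← hq, ← Nat.card_eq_fintype_card, SHull_eq_hullCodes]
  exact ncard_hullCodes (symplecticForm_isAlt n) (symplecticForm_nondegenerate n) (by simp) k₀ l hkn
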